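/- Let $E$ be a (real or complex) Hilbert space, let $\tau$ be a Hausdorff topology on $E$, and let $C$ be a bounded closed convex subset of $E$. Let $\{T(t) : t \ge 0\}$ be a one-parameter $\tau$-continuous semigroup of nonexpansive mappings on $C$; that is, each $T(t)$ maps $C$ into $C$ and 1. $T(s+t) = T(s)\circ T(t)$ for all $s,t \ge 0$; 2. for each $y \in C$, the mapping $t \mapsto T(t)y$ from $[0,\infty)$ into $C$ is continuous with respect to $\tau$; 3. $\|T(t)y - T(t)z\| \le \|y - z\|$ for all $t \ge 0$ and $y,z \in C$. (It is not required that $T(0)$ be the identity.) Let $\alpha,\beta > 0$ with $\alpha/\beta \notin \mathbb{Q}$, let $x \in C$, and define a sequence $\{x_n\}$ in $C$ by $$ x_n = \frac{1}{n}\sum_{k=1}^{n}\left(\frac{T(\alpha)+T(\beta)}{2}\right)^{k} x \qquad (n = 1, 2, 3, \dots), $$ where $\frac{T(\alpha)+T(\beta)}{2}$ denotes the mapping $y \mapsto \frac12\big(T(\alpha)y + T(\beta)y\big)$ of $C$ into itself and the exponent $k$ denotes its $k$-fold composition. Then $\{x_n\}$ converges weakly to a common fixed point of $\{T(t) : t \ge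 0\}$, that is, to a point $z \in C$ with $T(t)z = z$ for all $t \ge 0$. -/

import Mathlib

open scoped NNReal Topology

/-- `{T(t) : t ≥ 0}` is a one-parameter `τ`-continuous semigroup of nonexpansive mappings on `C`.
Mappings on `C` are represented by functions on `E` that send `C` into `C`;
only their restrictions to `C` matter. -/
structure IsNonexpansiveSemigroup {E : Type*} [NormedAddCommGroup E]
    (τ : TopologicalSpace E) (C : Set E) (T : ℝ≥0 → E → E) : Prop where
  mapsTo : ∀ t, Set.MapsTo (T t) C C
  comp : ∀ s t, ∀ x ∈ C, T (s + t) x = T s (T t x)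
  continuous : ∀ x ∈ C, Continuous[inferInstance, τ] (fun t : ℝ≥0 => T t x)
  nonexpansive : ∀ t, ∀ x ∈ C, ∀ y ∈ C, ‖T t x - T t y‖ ≤ ‖x - y‖

/-- The mapping `(S + T) / 2`. -/
noncomputable def halfSum {E : Type*} [AddCommGroup E] [Module ℝ E] (S T : E → E) : E → E :=
  fun y => (1 / 2 : ℝ) • (S y + T y)

/-- The Cesàro mean `(U x + U² x + ⋯ + Uⁿ x) / n` (only `n ≥ 1` is meaningful). -/
noncomputable def cesaroMean {E : Type*} [AddCommGroup E] [Module ℝ E]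
    (U : E → E) (x : E) (n : ℕ) : E :=
  (1 / (n : ℝ)) • ∑ k ∈ Finset.Icc 1 n, U^[k] x

/-- The sequence `u` converges to `z` in the weak topology that the norm topology of `E` induces. -/
def WeaklyConvergesTo (𝕜 : Type*) {E : Type*} [RCLike 𝕜] [NormedAddCommGroup E] [NormedSpace 𝕜 E]
    (u : ℕ → E) (z : E) : Prop :=
  Filter.Tendsto (fun n => toWeakSpace 𝕜 E (u n)) Filter.atTop (𝓝 (toWeakSpace 𝕜 E z))

/-!
Put `U = (T(α) + T(β)) / 2`, a nonexpansive self-map of `C`. The proof combines three facts.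

* Baillon's nonlinear ergodic theorem (`exists_fixedPoint_tendsto_inner_cesaroMean`): the Cesàro
  means of `U` converge weakly to a fixed point `z` of `U`. They lie in the weakly compact set `C`;
  each weak cluster point is a fixed point (`apply_eq_self_of_tendsto_inner_cesaroMean`), and there
  is only one cluster point (`exists_tendsto_inner_cesaroMean`). Limits along ultrafilters take the
  place of weakly convergent subsequences.
* Each fixed point of `U` is fixed by `T(α)` and by `T(β)` (`fixed_of_halfSum_fixed`). This follows
  from strict convexity once the commuting maps `T(α)` and `T(β)` are known to have some common fixed
  point (`exists_common_fixedPoint`).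
* A point fixed by `T(α)` and `T(β)` is fixed by the whole semigroup, as `α` and `β` generate a dense
  subgroup of `ℝ` (`IsNonexpansiveSemigroup.fixed_of_irrational`).

The weak topology over `𝕜` is tested on real parts of inner products
(`weaklyConvergesTo_of_tendsto_re_inner`), so that the argument takes place in a real Hilbert space.
-/

open Filter InnerProductSpace

/-! ### Weak compactness and sets of fixed points -/

theorem isClosed_fixedPoints_inter {E : Type*} [NormedAddCommGroup E] {C : Set E}
    (hc : IsClosed C) {S : E → E}
    (hS : ∀ x ∈ C, ∀ y ∈ C, ‖S x - S y‖ ≤ ‖x - y‖) : IsClosed {y ∈ C | S y = y} := by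
  have hL : ContinuousOn S C :=
    (LipschitzOnWith.of_dist_le_mul (K := 1) fun x hx y hy => by
      simpa [dist_eq_norm] using hS x hx y hy).continuousOn
  have := (hL.sub continuousOn_id).preimage_isClosed_of_isClosed hc (isClosed_singleton (x := 0))
  convert this using 1
  ext y
  simp [sub_eq_zero]

section HilbertSpace

variable {H : Type*} [NormedAddCommGroup H] [InnerProductSpace ℝ H]

/-- Weak compactness of bounded closed convex sets, in terms of ultrafilters. The limit comes from
the Banach-Alaoglu theorem through the Riesz isomorphism. -/
theorem exists_mem_tendsto_inner_of_eventually_mem [CompleteSpace H] {ι : Type*} {C : Set H}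
    (hb : Bornology.IsBounded C) (hc : IsClosed C) (hconv : Convex ℝ C)
    (F : Ultrafilter ι) (u : ι → H) (hu : ∀ᶠ i in (F : Filter ι), u i ∈ C) :
    ∃ z ∈ C, ∀ w, Tendsto (fun i => ⟪u i, w⟫_ℝ) F (𝓝 ⟪z, w⟫_ℝ) := by
  obtain ⟨R, hR⟩ := hb.subset_closedBall (0 : H)
  let g : ι → WeakDual ℝ H := fun i => StrongDual.toWeakDual (toDual ℝ H (u i))
  have hg : (F.map g : Filter (WeakDual ℝ H)) ≤
      𝓟 (WeakDual.toStrongDual ⁻¹' Metric.closedBall (0 : StrongDual ℝ H) R) := by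
    rw [Ultrafilter.coe_map, le_principal_iff]
    exact hu.mono fun i hi => by simpa [g] using hR hi
  obtain ⟨f, -, hf⟩ := (WeakDual.isCompact_closedBall 0 R).ultrafilter_le_nhds _ hg
  obtain ⟨z, hz⟩ := (toDual ℝ H).surjective (WeakDual.toStrongDual f)
  have hlim : ∀ w, Tendsto (fun i => ⟪u i, w⟫_ℝ) F (𝓝 ⟪z, w⟫_ℝ) := by
    intro w
    have h1 : ⟪z, w⟫_ℝ = f w := by
      rw [← toDual_apply_apply (𝕜 := ℝ), hz, WeakDual.toStrongDual_apply]
    rw [h1]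
    have h2 : Tendsto g F (𝓝 f) := hf
    exact ((WeakDual.eval_continuous w).tendsto f).comp h2
  refine ⟨z, ?_, hlim⟩
  obtain ⟨i, hi⟩ := hu.exists
  -- The metric projection `p` of `z` onto `C` satisfies `⟪z - p, c - p⟫ ≤ 0` on `C`; in the limit
  -- this reads `‖z - p‖ ^ 2 ≤ 0`.
  obtain ⟨p, hp, hpz⟩ := exists_norm_eq_iInf_of_complete_convex ⟨_, hi⟩ hc.isComplete hconv z
  rw [norm_eq_iInf_iff_real_inner_le_zero hconv hp] at hpz
  have h3 : ⟪z, z - p⟫_ℝ ≤ ⟪p, z - p⟫_ℝ := by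
    refine le_of_tendsto (hlim (z - p)) ?_
    filter_upwards [hu] with i hi
    have := hpz _ hi
    rw [real_inner_comm, inner_sub_left] at this
    linarith
  have h4 : ⟪z - p, z - p⟫_ℝ ≤ 0 := by rw [inner_sub_left]; linarith
  have h5 : z - p = 0 := by
    rwa [real_inner_self_eq_norm_sq, sq_nonpos_iff, norm_eq_zero] at h4
  rwa [sub_eq_zero.mp h5]

/-- Stewart's identity. It carries the strict convexity of Hilbert spaces in all that follows. -/
theorem norm_sub_convexCombination_sq (u p q : H) {a b : ℝ} (hab : a + b = 1) :
    ‖u - (a • p + b • q)‖ ^ 2 =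
      a * ‖u - p‖ ^ 2 + b * ‖u - q‖ ^ 2 - a * b * ‖p - q‖ ^ 2 := by
  obtain rfl : b = 1 - a := by linarith
  simp only [← real_inner_self_eq_norm_sq, inner_sub_left, inner_sub_right, inner_add_left,
    inner_add_right, real_inner_smul_left, real_inner_smul_right, real_inner_comm u p,
    real_inner_comm u q, real_inner_comm p q]
  ring

theorem convex_fixedPoints_inter {C : Set H} (hconv : Convex ℝ C) {S : H → H}
    (hS : ∀ x ∈ C, ∀ y ∈ C, ‖S x - S y‖ ≤ ‖x - y‖) : Convex ℝ {y ∈ C | S y = y} := by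
  rintro p ⟨hp, hSp⟩ q ⟨hq, hSq⟩ a b ha hb hab
  have hm := hconv hp hq ha hb hab
  refine ⟨hm, ?_⟩
  set m := a • p + b • q with hm_def
  have h1 : ‖S m - p‖ ≤ ‖m - p‖ := by simpa only [hSp] using hS m hm p hp
  have h2 : ‖S m - q‖ ≤ ‖m - q‖ := by simpa only [hSq] using hS m hm q hq
  have h3 := norm_sub_convexCombination_sq (S m) p q hab
  have h4 := norm_sub_convexCombination_sq m p q hab
  rw [← hm_def, sub_self, norm_zero] at h4
  rw [← hm_def] at h3
  have h5 : ‖S m - m‖ ^ 2 ≤ 0 := by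
    have h1' : ‖S m - p‖ ^ 2 ≤ ‖m - p‖ ^ 2 := by gcongr
    have h2' : ‖S m - q‖ ^ 2 ≤ ‖m - q‖ ^ 2 := by gcongr
    nlinarith [mul_le_mul_of_nonneg_left h1' ha, mul_le_mul_of_nonneg_left h2' hb]
  rw [← sub_eq_zero, ← norm_eq_zero]
  exact pow_eq_zero_iff two_ne_zero |>.mp (le_antisymm h5 (sq_nonneg _))

/-! ### The nonlinear ergodic theorem -/

theorem cesaroMean_eq_sum_range (S : H → H) (x : H) (n : ℕ) :
    cesaroMean S x n = (n : ℝ)⁻¹ • ∑ k ∈ Finset.range n, S^[k + 1] x := by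
  rw [cesaroMean, one_div, Finset.range_eq_Ico, Finset.sum_Ico_add' (fun k => S^[k] x) 0 n 1,
    zero_add]
  rfl

theorem inner_cesaroMean (S : H → H) (x w : H) (n : ℕ) :
    ⟪cesaroMean S x n, w⟫_ℝ = (n : ℝ)⁻¹ * ∑ k ∈ Finset.range n, ⟪S^[k + 1] x, w⟫_ℝ := by
  rw [cesaroMean_eq_sum_range, real_inner_smul_left, sum_inner]

theorem cesaroMean_mem {C : Set H} (hconv : Convex ℝ C) {S : H → H} (hm : Set.MapsTo S C C)
    {x : H} (hx : x ∈ C) {n : ℕ} (hn : n ≠ 0) : cesaroMean S x n ∈ C := by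
  rw [cesaroMean_eq_sum_range, Finset.smul_sum]
  refine hconv.sum_mem (fun _ _ => by positivity) ?_ fun k _ => hm.iterate (k + 1) hx
  simp [hn]

/-- Expand `‖Sᵏ x - S z‖ ^ 2` around `z`, bound the term `‖Sᵏ x - z‖ ^ 2` below by
`‖Sᵏ⁺¹ x - S z‖ ^ 2`, and average over `1 ≤ k ≤ n`: the right-hand side telescopes. -/
theorem norm_sub_sq_add_inner_cesaroMean_le {C : Set H} {S : H → H} (hm : Set.MapsTo S C C)
    (hS : ∀ x ∈ C, ∀ y ∈ C, ‖S x - S y‖ ≤ ‖x - y‖) {x z : H} (hx : x ∈ C) (hz : z ∈ C) {n : ℕ}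
    (hn : n ≠ 0) :
    ‖z - S z‖ ^ 2 + 2 * ⟪cesaroMean S x n - z, z - S z⟫_ℝ ≤ (n : ℝ)⁻¹ * ‖S x - S z‖ ^ 2 := by
  have hn' : (n : ℝ) ≠ 0 := by exact_mod_cast hn
  have key : ∀ k, ‖z - S z‖ ^ 2 + 2 * ⟪S^[k + 1] x, z - S z⟫_ℝ - 2 * ⟪z, z - S z⟫_ℝ ≤
      ‖S^[k + 1] x - S z‖ ^ 2 - ‖S^[k + 1 + 1] x - S z‖ ^ 2 := by
    intro k
    have h1 : ‖S^[k + 1 + 1] x - S z‖ ^ 2 ≤ ‖S^[k + 1] x - z‖ ^ 2 := by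
      rw [Function.iterate_succ_apply']
      gcongr
      exact hS _ (hm.iterate _ hx) _ hz
    have h2 : ‖S^[k + 1] x - S z‖ ^ 2 = ‖S^[k + 1] x - z‖ ^ 2 +
        2 * (⟪S^[k + 1] x, z - S z⟫_ℝ - ⟪z, z - S z⟫_ℝ) + ‖z - S z‖ ^ 2 := by
      rw [← inner_sub_left, ← norm_add_sq_real, sub_add_sub_cancel]
    linarith
  have hsum := Finset.sum_le_sum fun k (_ : k ∈ Finset.range n) => key k
  rw [Finset.sum_range_sub' (fun k => ‖S^[k + 1] x - S z‖ ^ 2)] at hsum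
  simp only [Finset.sum_sub_distrib, Finset.sum_add_distrib, ← Finset.mul_sum, Finset.sum_const,
    Finset.card_range, nsmul_eq_mul, zero_add, Function.iterate_one] at hsum
  rw [inner_sub_left, inner_cesaroMean]
  have h3 := mul_le_mul_of_nonneg_left
    (hsum.trans (sub_le_self _ (sq_nonneg ‖S^[n + 1] x - S z‖)))
    (inv_nonneg.mpr (Nat.cast_nonneg (α := ℝ) n))
  refine le_trans (le_of_eq ?_) h3
  field_simp
  ring

/-- Weak cluster points of the Cesàro means are fixed points. -/
theorem apply_eq_self_of_tendsto_inner_cesaroMean {C : Set H} {S : H → H} (hm : Set.MapsTo S C C)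
    (hS : ∀ x ∈ C, ∀ y ∈ C, ‖S x - S y‖ ≤ ‖x - y‖) {x z : H} (hx : x ∈ C) (hz : z ∈ C)
    {F : Filter ℕ} [F.NeBot] (hF : F ≤ atTop)
    (hlim : ∀ w, Tendsto (fun n => ⟪cesaroMean S x n, w⟫_ℝ) F (𝓝 ⟪z, w⟫_ℝ)) : S z = z := by
  have h1 : Tendsto (fun n => ‖z - S z‖ ^ 2 + 2 * ⟪cesaroMean S x n - z, z - S z⟫_ℝ) F
      (𝓝 (‖z - S z‖ ^ 2)) := by
    have := (((hlim (z - S z)).sub_const ⟪z, z - S z⟫_ℝ).const_mul 2).const_add (‖z - S z‖ ^ 2)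
    simpa [inner_sub_left] using this
  have h2 : Tendsto (fun n : ℕ => (n : ℝ)⁻¹ * ‖S x - S z‖ ^ 2) F (𝓝 0) := by
    simpa using ((tendsto_inv_atTop_nhds_zero_nat (𝕜 := ℝ)).mono_left hF).mul_const
      (‖S x - S z‖ ^ 2)
  have h3 : ‖z - S z‖ ^ 2 ≤ 0 := by
    refine le_of_tendsto_of_tendsto h1 h2 ?_
    filter_upwards [hF (eventually_ne_atTop 0)] with n hn
    exact norm_sub_sq_add_inner_cesaroMean_le hm hS hx hz hn
  have h4 : ‖z - S z‖ = 0 := pow_eq_zero_iff two_ne_zero |>.mp (le_antisymm h3 (sq_nonneg _))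
  exact (sub_eq_zero.mp (norm_eq_zero.mp h4)).symm

/-- The fixed point theorem of Browder, Göhde and Kirk in a Hilbert space: any weak cluster point of
the Cesàro means will do. -/
theorem exists_fixedPoint [CompleteSpace H] {C : Set H} (hb : Bornology.IsBounded C)
    (hc : IsClosed C) (hconv : Convex ℝ C) (hne : C.Nonempty) {S : H → H} (hm : Set.MapsTo S C C)
    (hS : ∀ x ∈ C, ∀ y ∈ C, ‖S x - S y‖ ≤ ‖x - y‖) : ∃ z ∈ C, S z = z := by
  obtain ⟨x, hx⟩ := hne
  have hF : (Ultrafilter.of (atTop : Filter ℕ) : Filter ℕ) ≤ atTop := Ultrafilter.of_le _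
  obtain ⟨z, hz, hlim⟩ := exists_mem_tendsto_inner_of_eventually_mem hb hc hconv
    (Ultrafilter.of atTop) (cesaroMean S x)
    (hF ((eventually_ne_atTop 0).mono fun n hn => cesaroMean_mem hconv hm hx hn))
  exact ⟨z, hz, apply_eq_self_of_tendsto_inner_cesaroMean hm hS hx hz hF hlim⟩

/-- The distances from the orbit to `p` and to `q` decrease, hence converge, and the difference of their
squares is affine in `⟪Sᵏ x, p - q⟫`. Applied to two weak cluster points `p`, `q` of the Cesàro
means, this forces `p = q`. -/
theorem exists_tendsto_inner_cesaroMean {C : Set H} {S : H → H} (hm : Set.MapsTo S C C)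
    (hS : ∀ x ∈ C, ∀ y ∈ C, ‖S x - S y‖ ≤ ‖x - y‖) {x p q : H} (hx : x ∈ C) (hp : p ∈ C)
    (hSp : S p = p) (hq : q ∈ C) (hSq : S q = q) :
    ∃ l, Tendsto (fun n => ⟪cesaroMean S x n, p - q⟫_ℝ) atTop (𝓝 l) := by
  have hdist : ∀ r ∈ C, S r = r → ∃ d, Tendsto (fun k => ‖S^[k] x - r‖) atTop (𝓝 d) := by
    intro r hr hSr
    refine ⟨_, tendsto_atTop_ciInf (antitone_nat_of_succ_le fun k => ?_)
      ⟨0, Set.forall_mem_range.mpr fun _ => norm_nonneg _⟩⟩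
    have := hS _ (hm.iterate k hx) r hr
    rwa [hSr, ← Function.iterate_succ_apply' S] at this
  obtain ⟨d, hd⟩ := hdist p hp hSp
  obtain ⟨e, he⟩ := hdist q hq hSq
  have h1 : ∀ k, ⟪S^[k] x, p - q⟫_ℝ =
      (‖S^[k] x - q‖ ^ 2 - ‖S^[k] x - p‖ ^ 2 + (‖p‖ ^ 2 - ‖q‖ ^ 2)) / 2 := by
    intro k
    rw [norm_sub_sq_real, norm_sub_sq_real, inner_sub_right]
    ring
  have h2 : Tendsto (fun k => ⟪S^[k] x, p - q⟫_ℝ) atTop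
      (𝓝 ((e ^ 2 - d ^ 2 + (‖p‖ ^ 2 - ‖q‖ ^ 2)) / 2)) := by
    simp only [h1]
    exact (((he.pow 2).sub (hd.pow 2)).add_const _).div_const 2
  refine ⟨(e ^ 2 - d ^ 2 + (‖p‖ ^ 2 - ‖q‖ ^ 2)) / 2, ?_⟩
  simp only [inner_cesaroMean]
  exact (h2.comp (tendsto_add_atTop_nat 1)).cesaro

/-- Baillon's nonlinear ergodic theorem. -/
theorem exists_fixedPoint_tendsto_inner_cesaroMean [CompleteSpace H] {C : Set H}
    (hb : Bornology.IsBounded C) (hc : IsClosed C) (hconv : Convex ℝ C) {S : H → H}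
    (hm : Set.MapsTo S C C) (hS : ∀ x ∈ C, ∀ y ∈ C, ‖S x - S y‖ ≤ ‖x - y‖) {x : H} (hx : x ∈ C) :
    ∃ z ∈ C, S z = z ∧
      ∀ w, Tendsto (fun n => ⟪cesaroMean S x n, w⟫_ℝ) atTop (𝓝 ⟪z, w⟫_ℝ) := by
  have hcluster : ∀ F : Ultrafilter ℕ, (F : Filter ℕ) ≤ atTop → ∃ z ∈ C, S z = z ∧
      ∀ w, Tendsto (fun n => ⟪cesaroMean S x n, w⟫_ℝ) F (𝓝 ⟪z, w⟫_ℝ) := by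
    intro F hF
    obtain ⟨z, hz, hlim⟩ := exists_mem_tendsto_inner_of_eventually_mem hb hc hconv F
      (cesaroMean S x)
      (hF ((eventually_ne_atTop 0).mono fun n hn => cesaroMean_mem hconv hm hx hn))
    exact ⟨z, hz, apply_eq_self_of_tendsto_inner_cesaroMean hm hS hx hz hF hlim, hlim⟩
  -- The limit along one ultrafilter finer than `atTop` is the limit along every other.
  have hF₀ : (Ultrafilter.of (atTop : Filter ℕ) : Filter ℕ) ≤ atTop := Ultrafilter.of_le _
  obtain ⟨z, hz, hSz, hlim⟩ := hcluster _ hF₀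
  refine ⟨z, hz, hSz, fun w => (tendsto_iff_ultrafilter _ _ _).mpr fun F hF => ?_⟩
  obtain ⟨z', hz', hSz', hlim'⟩ := hcluster F hF
  obtain ⟨l, hl⟩ := exists_tendsto_inner_cesaroMean hm hS hx hz hSz hz' hSz'
  have h1 : ⟪z, z - z'⟫_ℝ = l := tendsto_nhds_unique (hlim _) (hl.mono_left hF₀)
  have h2 : ⟪z', z - z'⟫_ℝ = l := tendsto_nhds_unique (hlim' _) (hl.mono_left hF)
  have h3 : z = z' := by
    rw [← sub_eq_zero, ← inner_self_eq_zero (𝕜 := ℝ), inner_sub_left, h1, h2, sub_self]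
  rw [h3]
  exact hlim' w

/-! ### Common fixed points of two commuting mappings -/

theorem halfSum_mapsTo {C : Set H} (hconv : Convex ℝ C) {A B : H → H} (hA : Set.MapsTo A C C)
    (hB : Set.MapsTo B C C) : Set.MapsTo (halfSum A B) C C := by
  intro y hy
  rw [halfSum, smul_add]
  exact hconv (hA hy) (hB hy) (by norm_num) (by norm_num) (by norm_num)

theorem norm_halfSum_sub_le {C : Set H} {A B : H → H}
    (hA : ∀ x ∈ C, ∀ y ∈ C, ‖A x - A y‖ ≤ ‖x - y‖) (hB : ∀ x ∈ C, ∀ y ∈ C, ‖B x - B y‖ ≤ ‖x - y‖) :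
    ∀ x ∈ C, ∀ y ∈ C, ‖halfSum A B x - halfSum A B y‖ ≤ ‖x - y‖ := by
  intro x hx y hy
  have h : halfSum A B x - halfSum A B y = (1 / 2 : ℝ) • ((A x - A y) + (B x - B y)) := by
    rw [halfSum, halfSum, ← smul_sub]
    congr 1
    abel
  rw [h, norm_smul, Real.norm_of_nonneg (by norm_num)]
  linarith [norm_add_le (A x - A y) (B x - B y), hA x hx y hy, hB x hx y hy]

/-- Commuting nonexpansive mappings have a common fixed point: `B` maps the closed convex set of fixed
points of `A` into itself. -/
theorem exists_common_fixedPoint [CompleteSpace H] {C : Set H} (hb : Bornology.IsBounded C)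
    (hc : IsClosed C) (hconv : Convex ℝ C) (hne : C.Nonempty) {A B : H → H}
    (hmA : Set.MapsTo A C C) (hA : ∀ x ∈ C, ∀ y ∈ C, ‖A x - A y‖ ≤ ‖x - y‖)
    (hmB : Set.MapsTo B C C) (hB : ∀ x ∈ C, ∀ y ∈ C, ‖B x - B y‖ ≤ ‖x - y‖)
    (hAB : ∀ x ∈ C, A (B x) = B (A x)) : ∃ p ∈ C, A p = p ∧ B p = p := by
  obtain ⟨p, hp, hAp⟩ := exists_fixedPoint hb hc hconv hne hmA hA
  have hsub : {y ∈ C | A y = y} ⊆ C := Set.sep_subset _ _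
  obtain ⟨z, ⟨hz, hAz⟩, hBz⟩ := exists_fixedPoint (S := B) (hb.subset hsub)
    (isClosed_fixedPoints_inter hc hA) (convex_fixedPoints_inter hconv hA) ⟨p, hp, hAp⟩
    (fun y ⟨hy, hAy⟩ => ⟨hmB hy, by rw [hAB y hy, hAy]⟩)
    (fun x hx y hy => hB x (hsub hx) y (hsub hy))
  exact ⟨z, hz, hAz, hBz⟩

/-- Let `p` be a common fixed point. Then `A z` and `B z` lie in the ball around `p` of radius
`‖z - p‖`, and their midpoint `z` lies on its boundary, so strict convexity gives `A z = B z`. -/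
theorem fixed_of_halfSum_fixed {C : Set H} {A B : H → H}
    (hA : ∀ x ∈ C, ∀ y ∈ C, ‖A x - A y‖ ≤ ‖x - y‖) (hB : ∀ x ∈ C, ∀ y ∈ C, ‖B x - B y‖ ≤ ‖x - y‖)
    {p : H} (hp : p ∈ C) (hAp : A p = p) (hBp : B p = p) {z : H} (hz : z ∈ C)
    (hfix : halfSum A B z = z) : A z = z ∧ B z = z := by
  rw [halfSum, smul_add] at hfix
  have h1 := norm_sub_convexCombination_sq p (A z) (B z) (a := 1 / 2) (b := 1 / 2) (by norm_num)
  rw [hfix] at h1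
  have h2 : ‖p - A z‖ ^ 2 ≤ ‖p - z‖ ^ 2 := by
    gcongr
    simpa only [hAp] using hA p hp z hz
  have h3 : ‖p - B z‖ ^ 2 ≤ ‖p - z‖ ^ 2 := by
    gcongr
    simpa only [hBp] using hB p hp z hz
  have h4 : ‖A z - B z‖ ^ 2 = 0 := le_antisymm (by linarith) (sq_nonneg _)
  have h5 : A z = B z := by
    rwa [sq_eq_zero_iff, norm_eq_zero, sub_eq_zero] at h4
  have h6 : A z = z := by
    rw [← h5, ← add_smul] at hfix
    norm_num at hfix
    exact hfix
  exact ⟨h6, h5 ▸ h6⟩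

end HilbertSpace

/-! ### Semigroups -/

/-- A point fixed by `T α` and `T β` is fixed by `T s` for each `s ≥ 0` in the subgroup of `ℝ` that
`α` and `β` generate. This subgroup is dense, and `t ↦ T t z` is `τ`-continuous with `τ` Hausdorff. -/
theorem IsNonexpansiveSemigroup.fixed_of_irrational {E : Type*} [NormedAddCommGroup E]
    {τ : TopologicalSpace E} (hτ : @T2Space E τ) {C : Set E} {T : ℝ≥0 → E → E}
    (hT : IsNonexpansiveSemigroup τ C T) {α β : ℝ≥0}
    (hαβ : Irrational ((α : ℝ) / (β : ℝ))) {z : E} (hz : z ∈ C) (hα : T α z = z)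
    (hβ : T β z = z) (t : ℝ≥0) : T t z = z := by
  have h0 : T 0 z = z := by
    have := hT.comp 0 α z hz
    rwa [zero_add, hα, eq_comm] at this
  have hmul : ∀ s, T s z = z → ∀ k : ℕ, T (k * s) z = z := by
    intro s hs k
    induction k with
    | zero => simpa using h0
    | succ k ih => rw [Nat.cast_succ, add_mul, one_mul, hT.comp _ _ z hz, hs, ih]
  have hcomb : ∀ a b : ℕ, T (a * α + b * β) z = z := fun a b => by
    rw [hT.comp _ _ z hz, hmul β hβ, hmul α hα]
  -- For `s = m α + n β ≥ 0`, shift `s` by natural multiples of `α` and `β` that make both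
  -- coefficients nonnegative.
  have hgroup : ∀ s ∈ AddSubgroup.closure {(α : ℝ), (β : ℝ)}, 0 ≤ s → T s.toNNReal z = z := by
    intro s hs hs0
    obtain ⟨m, n, rfl⟩ := AddSubgroup.mem_closure_pair.mp hs
    set s : ℝ := m • (α : ℝ) + n • (β : ℝ) with hs_def
    have hshift : s.toNNReal + ((-m).toNat * α + (-n).toNat * β) =
        m.toNat * α + n.toNat * β := by
      have hm : (m : ℝ) = (m.toNat : ℝ) - ((-m).toNat : ℝ) := by
        exact_mod_cast (Int.toNat_sub_toNat_neg m).symm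
      have hn : (n : ℝ) = (n.toNat : ℝ) - ((-n).toNat : ℝ) := by
        exact_mod_cast (Int.toNat_sub_toNat_neg n).symm
      rw [← NNReal.coe_inj]
      push_cast
      rw [Real.coe_toNNReal _ hs0, hs_def, zsmul_eq_mul, zsmul_eq_mul, hm, hn]
      ring
    have := hT.comp s.toNNReal ((-m).toNat * α + (-n).toNat * β) z hz
    rwa [hshift, hcomb, hcomb, eq_comm] at this
  have hdense : Dense (AddSubgroup.closure {(α : ℝ), (β : ℝ)} : Set ℝ) :=
    dense_addSubgroupClosure_pair_iff.mpr hαβ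
  rcases eq_or_ne t 0 with rfl | ht
  · exact h0
  -- From here on `E` carries `τ` in place of the norm topology.
  let _ : TopologicalSpace E := τ
  have hclosed : IsClosed {s : ℝ | T s.toNNReal z = z} :=
    isClosed_eq ((hT.continuous z hz).comp continuous_real_toNNReal) continuous_const
  have hmem : (t : ℝ) ∈ closure (Set.Ioi 0 ∩ (AddSubgroup.closure {(α : ℝ), (β : ℝ)} : Set ℝ)) :=
    hdense.open_subset_closure_inter isOpen_Ioi (NNReal.coe_pos.mpr (pos_iff_ne_zero.mpr ht))
  have : T (t : ℝ).toNNReal z = z :=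
    closure_minimal (fun s hs => hgroup s hs.2 (le_of_lt hs.1)) hclosed hmem
  rwa [Real.toNNReal_coe] at this

/-! ### Passage to real scalars -/

/-- The real parts suffice, since `im ⟪v, y⟫ = re ⟪i v, y⟫`. -/
theorem weaklyConvergesTo_of_tendsto_re_inner {𝕜 E : Type*} [RCLike 𝕜] [NormedAddCommGroup E]
    [InnerProductSpace 𝕜 E] [CompleteSpace E] {u : ℕ → E} {z : E}
    (h : ∀ w, Tendsto (fun n => RCLike.re (inner 𝕜 (u n) w)) atTop
      (𝓝 (RCLike.re (inner 𝕜 z w)))) : WeaklyConvergesTo 𝕜 u z := by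
  refine (WeakBilin.tendsto_iff_forall_eval_tendsto (topDualPairing 𝕜 E).flip ?_).mpr ?_
  · intro a b hab
    exact ext_inner_left 𝕜 fun w => LinearMap.congr_fun hab (toDual 𝕜 E w)
  intro f
  obtain ⟨v, rfl⟩ := (toDual 𝕜 E).surjective f
  change Tendsto (fun n => inner 𝕜 v (u n)) atTop (𝓝 (inner 𝕜 v z))
  have hre : ∀ w, Tendsto (fun n => RCLike.re (inner 𝕜 w (u n))) atTop
      (𝓝 (RCLike.re (inner 𝕜 w z))) := fun w => by
    simpa only [inner_re_symm] using h w
  have him : Tendsto (fun n => RCLike.im (inner 𝕜 v (u n))) atTop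
      (𝓝 (RCLike.im (inner 𝕜 v z))) := by
    simpa [inner_smul_left] using hre ((RCLike.I : 𝕜) • v)
  have := ((RCLike.continuous_ofReal (K := 𝕜)).tendsto _).comp (hre v) |>.add
    ((((RCLike.continuous_ofReal (K := 𝕜)).tendsto _).comp him).mul_const RCLike.I)
  simpa only [Function.comp_def, RCLike.re_add_im] using this

/-- A Hilbert space over `𝕜`, as a real Hilbert space with inner product `re ⟪x, y⟫`. Unlike in
`InnerProductSpace.rclikeToReal`, the real vector space structure is the given one. -/
abbrev realInnerProductSpace (𝕜 E : Type*) [RCLike 𝕜] [NormedAddCommGroup E]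
    [InnerProductSpace 𝕜 E] [NormedSpace ℝ E] [IsScalarTower ℝ 𝕜 E] : InnerProductSpace ℝ E :=
  { ‹NormedSpace ℝ E› with
    inner := fun x y => RCLike.re (inner 𝕜 x y)
    norm_sq_eq_re_inner := fun x => norm_sq_eq_re_inner (𝕜 := 𝕜) x
    conj_inner_symm := fun x y => inner_re_symm y x
    add_left := fun x y z => by simp [inner_add_left]
    smul_left := fun x y r => by
      rw [← algebraMap_smul 𝕜 r x, inner_smul_left]
      simp }

theorem theorem5p2 {𝕜 E : Type*} [RCLike 𝕜] [NormedAddCommGroup E] [InnerProductSpace 𝕜 E]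
    [NormedSpace ℝ E] [IsScalarTower ℝ 𝕜 E] [CompleteSpace E]
    (C : Set E) (hC_bounded : Bornology.IsBounded C) (hC_closed : IsClosed C)
    (hC_convex : Convex ℝ C)
    (τ : TopologicalSpace E) (hτ : @T2Space E τ)
    (T : ℝ≥0 → E → E) (hT : IsNonexpansiveSemigroup τ C T)
    (α β : ℝ≥0) (hα : 0 < α) (hβ : 0 < β) (hαβ : Irrational ((α : ℝ) / (β : ℝ)))
    (x : E) (hx : x ∈ C) :
    ∃ z ∈ C, (∀ t : ℝ≥0, T t z = z) ∧
      WeaklyConvergesTo 𝕜 (cesaroMean (halfSum (T α) (T β)) x) z := by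
  let _ : InnerProductSpace ℝ E := realInnerProductSpace 𝕜 E
  have hcomm : ∀ y ∈ C, T α (T β y) = T β (T α y) := fun y hy => by
    rw [← hT.comp α β y hy, ← hT.comp β α y hy, add_comm]
  obtain ⟨p, hp, hαp, hβp⟩ := exists_common_fixedPoint hC_bounded hC_closed hC_convex ⟨x, hx⟩
    (hT.mapsTo α) (hT.nonexpansive α) (hT.mapsTo β) (hT.nonexpansive β) hcomm
  obtain ⟨z, hz, hfix, hlim⟩ := exists_fixedPoint_tendsto_inner_cesaroMean hC_bounded hC_closed
    hC_convex (halfSum_mapsTo hC_convex (hT.mapsTo α) (hT.mapsTo β))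
    (norm_halfSum_sub_le (hT.nonexpansive α) (hT.nonexpansive β)) hx
  obtain ⟨hαz, hβz⟩ := fixed_of_halfSum_fixed (hT.nonexpansive α) (hT.nonexpansive β) hp hαp hβp
    hz hfix
  exact ⟨z, hz, hT.fixed_of_irrational hτ hαβ hz hαz hβz,
    weaklyConvergesTo_of_tendsto_re_inner hlim⟩
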